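/- Let $X\subseteq\mathbb{R}$ be a nondegenerate interval (possibly $X=\mathbb{R}$), let $\mathcal P(X)$ be the set of Borel probability measures on $\mathbb{R}$ carried by $X$, and let $c:X\times X\to[0,\infty)$ be twice differentiable with $\frac{\partial^2 c(x,x')}{\partial x\,\partial x'}<0$ on $X\times X$. For $\gamma,\omega\in\mathcal P(X)$ let $C(\gamma,\omega)=\inf_{\pi\in\Pi(\gamma,\omega)}\int c\,d\pi\in[0,\infty]$ be the optimal transport cost, where $\Pi(\gamma,\omega)$ is the set of probability measures with marginals $\gamma$ and $\omega$, and let $Q_\gamma(t)=\inf\{x\in\mathbb{R}: t\le \gamma((-\infty,x])\}$, $t\in(0,1)$, be the quantile function. Fix $\eta>0$ and put $e^{-\infty}=0$. A loss $\lambda:\Gamma\times\Omega\to[0,\infty]$ is $\eta$-mixable if for all $N\ge 1$, all probability vectors $w=(w^1,\dots,w^N)$ and all $\gamma^1,\dots,\gamma^N\in\Gamma$ there is $\overline\gamma\in\Gamma$ such that $e^{-\eta\lambda(\overline\gamma,\omega)}\ge\sum_{n=1}^N w^n e^{-\eta\lambda(\gamma^n,\omega)}$ for all $\omega\in\Omega$.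 A substitution function $\Sigma_\lambda$ (for $N$ experts) assigns to each $(\gamma^1,\dots,\gamma^N)\in\Gamma^N$ and each $w$ such a $\overline\gamma$. If $\Gamma\subseteq\mathbb{R}$ is convex, $\lambda$ is $\eta$-exponentially concave if one may always take $\overline\gamma=\sum_n w^n\gamma^n$. 1. Let $N\ge1$, let $\Sigma_c$ be a substitution function for $c$ at rate $\eta$ with $N$ experts, let $w$ be a probability vector for which $\Sigma_c(\cdot,w):X^N\to X$ is measurable, and let $\gamma^1,\dots,\gamma^N\in\mathcal P(X)$. Put $\overline Q(t)=\Sigma_c\big(\{Q_{\gamma^n}(t),w^n\}_{n=1}^N\big)$ and let $\overline\gamma$ be the pushforward of the uniform distribution on $[0,1]$ under $\overline Q$. Then $\overline\gamma\in\mathcal P(X)$ and $$\exp\big(-\eta C(\overline\gamma,\omega)\big)\ \ge\ \sum_{n=1}^N w^n\exp\big(-\eta C(\gamma^n,\omega)\big)\qquad\text{for all }\omega\in\mathcal P(X).$$ 2. If $c$ is $\eta$-mixable, then $C$ is $\eta$-mixable on $\mathcal P(X)\times\mathcal P(X)$. 3. If $c$ is $\eta$-exponentially concave, then for all $N\ge1$,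 all probability vectors $w$ and all $\gamma^1,\dots,\gamma^N\in\mathcal P(X)$ the weighted mean is a substitution function for $c$, and the pushforward $\overline\gamma$ of the uniform distribution on $[0,1]$ under $\overline Q=\sum_n w^nQ_{\gamma^n}$ lies in $\mathcal P(X)$, has quantile function $\overline Q$ on $(0,1)$, and satisfies the inequality of part 1. If moreover all $\gamma^n$ have finite second moment, then $\overline\gamma$ is the unique Wasserstein-2 barycenter of $\gamma^1,\dots,\gamma^N$ with weights $w$, i.e. the unique minimizer of $\nu\mapsto\sum_n w^n\mathbb W_2^2(\gamma^n,\nu)$ over the Borel probability measures on $\mathbb{R}$ with finite second moment. -/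

import Mathlib

open MeasureTheory ProbabilityTheory Set
open scoped ENNReal

noncomputable section

/-- `exp(-η L)` for an extended real loss `L`, with `exp(-∞) = 0`. -/
def expLoss (η : ℝ) (L : EReal) : ℝ≥0∞ := EReal.exp (-((η : EReal) * L))

/-- `η`-mixability of a loss on `G × O`: any finite family of forecasts in `G`, with any
probability vector of weights, has an aggregated forecast in `G`. -/
def IsMixableOn {Γ Ω : Type*} (G : Set Γ) (O : Set Ω) (η : ℝ) (loss : Γ → Ω → EReal) : Prop :=
  ∀ (N : ℕ) (w : Fin N → ℝ) (γ : Fin N → Γ), w ∈ stdSimplex ℝ (Fin N) → (∀ n, γ n ∈ G) →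
    ∃ g ∈ G, ∀ ω ∈ O,
      ∑ n, ENNReal.ofReal (w n) * expLoss η (loss (γ n) ω) ≤ expLoss η (loss g ω)

/-- `S` is a substitution function (for `N` experts) of the loss on `G × O` at rate `η`:
it maps forecasts in `G` and a probability vector to an aggregated forecast in `G`. -/
def IsSubstitution {Γ Ω : Type*} (G : Set Γ) (O : Set Ω) (η : ℝ) (loss : Γ → Ω → EReal) {N : ℕ}
    (S : (Fin N → Γ) → (Fin N → ℝ) → Γ) : Prop :=
  ∀ (γ : Fin N → Γ) (w : Fin N → ℝ), (∀ n, γ n ∈ G) → w ∈ stdSimplex ℝ (Fin N) →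
    S γ w ∈ G ∧ ∀ ω ∈ O,
      ∑ n, ENNReal.ofReal (w n) * expLoss η (loss (γ n) ω) ≤ expLoss η (loss (S γ w) ω)

/-- The weighted arithmetic mean. -/
def weightedMean {N : ℕ} (x w : Fin N → ℝ) : ℝ := ∑ n, w n * x n

/-- `η`-exponential concavity (in the forecast) of a loss on `G × O`, where `G` is a convex
set of real forecasts. -/
def IsExpConcaveOn {Ω : Type*} (G : Set ℝ) (O : Set Ω) (η : ℝ) (loss : ℝ → Ω → EReal) : Prop :=
  ∀ (N : ℕ) (w : Fin N → ℝ) (x : Fin N → ℝ), w ∈ stdSimplex ℝ (Fin N) → (∀ n, x n ∈ G) →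
    ∀ ω ∈ O,
      ∑ n, ENNReal.ofReal (w n) * expLoss η (loss (x n) ω) ≤ expLoss η (loss (weightedMean x w) ω)

/-- The Borel probability measures on `ℝ` carried by `X`. -/
def probOn (X : Set ℝ) : Set (Measure ℝ) := {γ | IsProbabilityMeasure γ ∧ γ Xᶜ = 0}

/-- The transport plans between `γ` and `ω`. -/
def transportPlans (γ ω : Measure ℝ) : Set (Measure (ℝ × ℝ)) :=
  {π | IsProbabilityMeasure π ∧ π.map Prod.fst = γ ∧ π.map Prod.snd = ω}

/-- The (Kantorovich) optimal transport cost, in `[0, ∞]`, for a cost function that is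
nonnegative where the measures live. -/
def transportCost (c : ℝ → ℝ → ℝ) (γ ω : Measure ℝ) : ℝ≥0∞ :=
  ⨅ π ∈ transportPlans γ ω, ∫⁻ p, ENNReal.ofReal (c p.1 p.2) ∂π

/-- The quantile function; only its values on `(0, 1)` are meaningful. -/
def quantile (γ : Measure ℝ) (t : ℝ) : ℝ := sInf {x : ℝ | t ≤ cdf γ x}

/-- The pointwise aggregate of the quantile functions of the experts' forecasts. -/
def aggregateQuantile {N : ℕ} (S : (Fin N → ℝ) → (Fin N → ℝ) → ℝ) (w : Fin N → ℝ)
    (γ : Fin N → Measure ℝ) (t : ℝ) : ℝ :=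
  S (fun n => quantile (γ n) t) w

/-- The law of the aggregated quantile function at a uniform random point of `[0, 1]`. -/
def implicitAggregate {N : ℕ} (S : (Fin N → ℝ) → (Fin N → ℝ) → ℝ) (w : Fin N → ℝ)
    (γ : Fin N → Measure ℝ) : Measure ℝ :=
  (volume.restrict (Icc (0 : ℝ) 1)).map (aggregateQuantile S w γ)

/-- Twice (Fréchet) differentiable on `X × X`, in the within-the-set sense. -/
def TwiceDifferentiableOn (c : ℝ → ℝ → ℝ) (X : Set ℝ) : Prop :=
  DifferentiableOn ℝ (Function.uncurry c) (X ×ˢ X) ∧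
    DifferentiableOn ℝ (fderivWithin ℝ (Function.uncurry c) (X ×ˢ X)) (X ×ˢ X)

/-- The mixed second partial derivative `∂²c/∂x∂x'` at `(x, x')`, relative to `X × X`. -/
def mixedPartial (c : ℝ → ℝ → ℝ) (X : Set ℝ) (x x' : ℝ) : ℝ :=
  derivWithin (fun s => derivWithin (fun t => c s t) X x') X x

/-- The Borel probability measures on `ℝ` with finite second moment. -/
def probTwo : Set (Measure ℝ) := {γ | IsProbabilityMeasure γ ∧ MemLp id 2 γ}

/-- The squared Wasserstein-2 distance. -/
def wassersteinTwoSq (γ ω : Measure ℝ) : ℝ≥0∞ := transportCost (fun x x' => (x - x') ^ 2) γ ω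

/-- `ν` is a Wasserstein-2 barycenter of the `γ n` with weights `w n`. -/
def IsWassersteinTwoBarycenter {N : ℕ} (w : Fin N → ℝ) (γ : Fin N → Measure ℝ)
    (ν : Measure ℝ) : Prop :=
  ν ∈ probTwo ∧ ∀ ν' ∈ probTwo,
    ∑ n, ENNReal.ofReal (w n) * wassersteinTwoSq (γ n) ν ≤
      ∑ n, ENNReal.ofReal (w n) * wassersteinTwoSq (γ n) ν'

end

/-!
The proof rests on two facts. First, the transport cost is attained by the comonotone coupling:
`C(γ, ω) = ∫ c(Q_γ(t), Q_ω(t)) dt` over `(0, 1)`, for the given `c ≥ 0`, with no integrability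
assumption (`transportCost_eq_lintegral_quantile`). A negative mixed partial derivative makes `c`
submodular (`submodularCostOn_of_mixedPartial_neg`), so sorting both coordinates of a finite sample
does not increase the sum of the costs (`SubmodularCostOn.sum_sort_le`). For an arbitrary plan `π` of
finite cost, the strong law of large numbers provides a sample whose mean cost tends to `∫ c dπ` and
whose empirical distribution functions converge at all rationals; the sorted samples then converge to
the quantile functions, and Fatou's lemma yields the bound.

Second, a pointwise inequality `exp (-η f) ≥ ∑ wₙ exp (-η gₙ)` may be integrated in the exponents
(`sum_expLoss_lintegral_le`), by Jensen's inequality for `exp`. Applied to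
`gₙ(t) = c(Q_{γₙ}(t), Q_ω(t))` and `f(t) = c(Q(t), Q_ω(t))`, where `Q` aggregates the `Q_{γₙ}`
pointwise, it gives the aggregation inequality for the law of `Q`, since `(Q, Q_ω)` is a coupling.

Mixability of `c` supplies an aggregated forecast for each vector of forecasts, but not measurably in
it. The admissible aggregates form a closed relation in a `σ`-compact interval, and the least
admissible point in the first compact set of an exhaustion that meets the fibre is a measurable choice
(`exists_measurable_selection`).

With weighted means, `Q = ∑ wₙ Q_{γₙ}` is monotone and left-continuous, hence is the quantile function
of its law. As `W₂²` is the squared `L²` distance of quantile functions, the bias-variance identity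
(`sum_wassersteinTwoSq_eq`) shows that this law is the unique barycenter.
-/

open Filter Topology

/-! ### Quantile functions -/


/-- On `(0, 1)` the quantile function is the lower adjoint of the distribution function. -/
theorem quantile_le_iff (γ : Measure ℝ) {t : ℝ} (ht : t ∈ Ioo (0 : ℝ) 1) (x : ℝ) :
    quantile γ t ≤ x ↔ t ≤ cdf γ x := by
  have hne : {x : ℝ | t ≤ cdf γ x}.Nonempty :=
    ((tendsto_cdf_atTop γ).eventually_const_lt ht.2).exists.imp fun _ h => le_of_lt h
  have hbdd : BddBelow {x : ℝ | t ≤ cdf γ x} := by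
    obtain ⟨a, ha⟩ := ((tendsto_cdf_atBot γ).eventually_lt_const ht.1).exists
    refine ⟨a, fun y hy => ?_⟩
    by_contra hlt
    exact absurd (hy.trans (monotone_cdf γ (not_le.1 hlt).le)) (not_le.2 ha)
  refine ⟨fun h => ?_, fun h => csInf_le hbdd h⟩
  have hright : Tendsto (cdf γ) (𝓝[>] x) (𝓝 (cdf γ x)) :=
    ((cdf γ).right_continuous x).mono_left (nhdsWithin_mono _ Ioi_subset_Ici_self)
  refine ge_of_tendsto hright ?_
  filter_upwards [self_mem_nhdsWithin] with y hy
  obtain ⟨z, hz, hzy⟩ := exists_lt_of_csInf_lt hne (lt_of_le_of_lt h hy)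
  exact le_trans hz (monotone_cdf γ hzy.le)

theorem lt_quantile_iff (γ : Measure ℝ) {t : ℝ} (ht : t ∈ Ioo (0 : ℝ) 1) (x : ℝ) :
    x < quantile γ t ↔ cdf γ x < t := by
  rw [← not_le, quantile_le_iff γ ht, not_le]

theorem monotoneOn_quantile (γ : Measure ℝ) : MonotoneOn (quantile γ) (Ioo 0 1) := by
  intro s hs t ht hst
  rw [quantile_le_iff γ hs]
  exact hst.trans ((quantile_le_iff γ ht _).1 le_rfl)

theorem aemeasurable_quantile (γ : Measure ℝ) :
    AEMeasurable (quantile γ) (volume.restrict (Ioo 0 1)) :=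
  aemeasurable_restrict_of_monotoneOn measurableSet_Ioo (monotoneOn_quantile γ)

theorem tendsto_quantile_left (γ : Measure ℝ) {t : ℝ} (ht : t ∈ Ioo (0 : ℝ) 1) :
    Tendsto (quantile γ) (𝓝[<] t) (𝓝 (quantile γ t)) := by
  have hmem : Ioo 0 t ∈ 𝓝[<] t := Ioo_mem_nhdsLT ht.1
  refine tendsto_order.2 ⟨fun a ha => ?_, fun a ha => ?_⟩
  · have h1 := (lt_quantile_iff γ ht a).1 ha
    filter_upwards [hmem, Ioo_mem_nhdsLT h1] with s hs hs'
    exact (lt_quantile_iff γ ⟨hs.1, hs.2.trans ht.2⟩ a).2 hs'.1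
  · filter_upwards [hmem] with s hs
    exact (monotoneOn_quantile γ ⟨hs.1, hs.2.trans ht.2⟩ ht hs.2.le).trans_lt ha

/-- A monotone function on `(0, 1)` has at most countably many discontinuities. -/
theorem ae_continuousAt_quantile (γ : Measure ℝ) :
    ∀ᵐ t ∂volume.restrict (Ioo (0 : ℝ) 1), ContinuousAt (quantile γ) t := by
  have hc := (monotoneOn_quantile γ).countable_not_continuousWithinAt
  rw [ae_restrict_iff' measurableSet_Ioo]
  filter_upwards [hc.ae_notMem volume] with t ht htI
  by_contra hcon
  exact ht ⟨htI, fun h => hcon (h.continuousAt (Ioo_mem_nhds htI.1 htI.2))⟩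

instance isProbabilityMeasure_restrict_Ioo :
    IsProbabilityMeasure (volume.restrict (Ioo (0 : ℝ) 1)) := ⟨by simp⟩

/-- Quantile transform: the law of `quantile γ` at a uniform random point is `γ`. -/
theorem map_quantile (γ : Measure ℝ) [IsProbabilityMeasure γ] :
    (volume.restrict (Ioo (0 : ℝ) 1)).map (quantile γ) = γ := by
  have := Measure.isProbabilityMeasure_map (aemeasurable_quantile γ)
  refine Measure.ext_of_Iic _ _ fun x => ?_
  rw [Measure.map_apply_of_aemeasurable (aemeasurable_quantile γ) measurableSet_Iic,
    Measure.restrict_apply₀' measurableSet_Ioo.nullMeasurableSet, ← ofReal_cdf]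
  have hF1 := cdf_le_one γ x
  apply le_antisymm
  · calc volume (quantile γ ⁻¹' Iic x ∩ Ioo 0 1) ≤ volume (Ioc 0 (cdf γ x)) :=
        measure_mono fun t ht => ⟨ht.2.1, (quantile_le_iff γ ht.2 x).1 ht.1⟩
      _ = _ := by simp
  · calc ENNReal.ofReal (cdf γ x) = volume (Ioo 0 (cdf γ x)) := by simp
      _ ≤ _ := measure_mono fun t ht => by
        have h01 : t ∈ Ioo (0 : ℝ) 1 := ⟨ht.1, ht.2.trans_le hF1⟩
        exact ⟨(quantile_le_iff γ h01 x).2 ht.2.le, h01⟩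

/-- A monotone, left-continuous function on `(0, 1)` is the quantile function of the law of its
value at a uniform random point. -/
theorem quantile_map_of_monotoneOn {G : ℝ → ℝ} (hG : MonotoneOn G (Ioo 0 1))
    (hleft : ∀ t ∈ Ioo (0 : ℝ) 1, Tendsto G (𝓝[<] t) (𝓝 (G t))) {t : ℝ}
    (ht : t ∈ Ioo (0 : ℝ) 1) :
    quantile ((volume.restrict (Ioo (0 : ℝ) 1)).map G) t = G t := by
  have hGm : AEMeasurable G (volume.restrict (Ioo 0 1)) :=
    aemeasurable_restrict_of_monotoneOn measurableSet_Ioo hG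
  have := Measure.isProbabilityMeasure_map hGm
  suffices h : ∀ x, t ≤ cdf ((volume.restrict (Ioo (0 : ℝ) 1)).map G) x ↔ G t ≤ x by
    rw [quantile, show {x | t ≤ cdf ((volume.restrict (Ioo (0 : ℝ) 1)).map G) x} = Ici (G t) from
      Set.ext h, csInf_Ici]
  intro x
  rw [← ENNReal.ofReal_le_ofReal_iff (cdf_nonneg _ _), ofReal_cdf,
    Measure.map_apply_of_aemeasurable hGm measurableSet_Iic,
    Measure.restrict_apply₀' measurableSet_Ioo.nullMeasurableSet]
  refine ⟨fun h => ?_, fun h => ?_⟩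
  · by_contra hlt
    obtain ⟨s, hs, hxs⟩ := ((Ioo_mem_nhdsLT ht.1 : Ioo 0 t ∈ 𝓝[<] t) |> fun hm =>
      (eventually_of_mem hm fun _ h => h).and
        ((hleft t ht).eventually_const_lt (not_le.1 hlt))).exists
    have hsub : G ⁻¹' Iic x ∩ Ioo 0 1 ⊆ Ioc 0 s := by
      intro r hr
      refine ⟨hr.2.1, ?_⟩
      by_contra hsr
      exact absurd (hxs.trans_le (hG ⟨hs.1, hs.2.trans ht.2⟩ hr.2 (not_le.1 hsr).le))
        (not_lt.2 hr.1)
    have h2 := h.trans (measure_mono hsub)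
    rw [Real.volume_Ioc, sub_zero, ENNReal.ofReal_le_ofReal_iff hs.1.le] at h2
    exact absurd hs.2 (not_lt.2 h2)
  · calc ENNReal.ofReal t = volume (Ioo 0 t) := by simp
      _ ≤ _ := measure_mono fun s hs => by
        have h01 : s ∈ Ioo (0 : ℝ) 1 := ⟨hs.1, hs.2.trans ht.2⟩
        exact ⟨(hG h01 ht hs.2.le).trans h, h01⟩

theorem ae_of_ae_quantile {γ : Measure ℝ} [IsProbabilityMeasure γ] {p : ℝ → Prop}
    (h : ∀ᵐ x ∂γ, p x) : ∀ᵐ t ∂volume.restrict (Ioo (0 : ℝ) 1), p (quantile γ t) := by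
  rw [← map_quantile γ] at h
  exact ae_of_ae_map (aemeasurable_quantile γ) h

theorem ae_mem_of_mem_probOn {X : Set ℝ} {γ : Measure ℝ} (hγ : γ ∈ probOn X) :
    ∀ᵐ x ∂γ, x ∈ X := hγ.2

theorem ae_quantile_mem {X : Set ℝ} {γ : Measure ℝ} (hγ : γ ∈ probOn X) :
    ∀ᵐ t ∂volume.restrict (Ioo (0 : ℝ) 1), quantile γ t ∈ X :=
  have := hγ.1
  ae_of_ae_quantile (ae_mem_of_mem_probOn hγ)

/-! ### Optimality of the comonotone coupling for submodular costs -/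

/-- Submodularity on `X × X` (the Monge condition): matching small with small and large with large
costs at most as much as crossing. -/
def SubmodularCostOn (c : ℝ → ℝ → ℝ) (X : Set ℝ) : Prop :=
  ∀ x ∈ X, ∀ x' ∈ X, ∀ y ∈ X, ∀ y' ∈ X, x ≤ x' → y ≤ y' → c x y + c x' y' ≤ c x y' + c x' y

theorem SubmodularCostOn.sum_sort_le {c : ℝ → ℝ → ℝ} {X : Set ℝ} (hc : SubmodularCostOn c X)
    {n : ℕ} {x y : Fin n → ℝ} (hx : ∀ i, x i ∈ X) (hy : ∀ i, y i ∈ X) :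
    ∑ i, c ((x ∘ Tuple.sort x) i) ((y ∘ Tuple.sort y) i) ≤ ∑ i, c (x i) (y i) := by
  set σ := Tuple.sort x
  have hmono : Monotone (x ∘ σ) := Tuple.monotone_sort x
  have key : (∀ i, ((y ∘ σ) ∘ Tuple.sort (y ∘ σ)) i ∈ X) ∧
      ∑ i, c ((x ∘ σ) i) (((y ∘ σ) ∘ Tuple.sort (y ∘ σ)) i) ≤
        ∑ i, c ((x ∘ σ) i) ((y ∘ σ) i) := by
    refine Tuple.bubble_sort_induction
      (P := fun g => (∀ i, g i ∈ X) ∧ ∑ i, c ((x ∘ σ) i) (g i) ≤ ∑ i, c ((x ∘ σ) i) ((y ∘ σ) i))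
      ⟨fun i => hy _, le_rfl⟩ fun g i j hij hg ⟨hgX, hgs⟩ => ⟨fun k => hgX _, le_trans ?_ hgs⟩
    rw [← sub_nonpos, ← Finset.sum_sub_distrib, Fintype.sum_eq_add i j hij.ne]
    · have := hc _ (hx (σ i)) _ (hx (σ j)) _ (hgX j) _ (hgX i) (hmono hij.le) hg.le
      simp only [Function.comp_apply, Equiv.swap_apply_left, Equiv.swap_apply_right]
      linarith
    · rintro k ⟨hki, hkj⟩
      simp [Equiv.swap_apply_of_ne_of_ne hki hkj]
  rw [Tuple.comp_perm_comp_sort_eq_comp_sort] at key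
  exact key.2.trans_eq (Equiv.sum_comp σ fun i => c (x i) (y i))

/-- The `k`-th smallest (counting from `0`) of `u 0, …, u (n - 1)`; zero if `n ≤ k`. -/
noncomputable def orderStatistic (u : ℕ → ℝ) (n k : ℕ) : ℝ :=
  if h : k < n then u (Tuple.sort (fun i : Fin n => u i) ⟨k, h⟩) else 0

theorem orderStatistic_mem {u : ℕ → ℝ} {X : Set ℝ} (hu : ∀ i, u i ∈ X) {n k : ℕ} (h : k < n) :
    orderStatistic u n k ∈ X := by
  rw [orderStatistic, dif_pos h]
  exact hu _

theorem orderStatistic_le_iff (u : ℕ → ℝ) {n k : ℕ} (h : k < n) (a : ℝ) :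
    (orderStatistic u n k ≤ a) ↔ (k : ℝ) < ∑ i ∈ Finset.range n, (Iic a).indicator 1 (u i) := by
  have h1 := Tuple.lt_card_le_iff_apply_le_of_monotone
    (a := a) (Tuple.monotone_sort fun i : Fin n => u i) (j := ⟨k, h⟩)
  rw [orderStatistic, dif_pos h]
  refine h1.symm.trans ?_
  rw [Finset.sum_range fun i => (Iic a).indicator (1 : ℝ → ℝ) (u i),
    ← Equiv.sum_comp (Tuple.sort fun i : Fin n => u i)]
  simp only [Finset.card_filter, indicator_apply, mem_Iic, Function.comp_apply, Pi.one_apply]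
  rw [← Nat.cast_lt (α := ℝ)]
  push_cast
  rfl

theorem floor_mul_lt {n : ℕ} (hn : 0 < n) {t : ℝ} (ht : t ∈ Ioo (0 : ℝ) 1) :
    ⌊(n : ℝ) * t⌋₊ < n := by
  have : (0 : ℝ) < n := Nat.cast_pos.2 hn
  rw [Nat.floor_lt (by have := ht.1; positivity)]
  nlinarith [ht.2]

/-- Empirical quantiles converge to the quantile of the limit law at its continuity points. -/
theorem tendsto_orderStatistic {u : ℕ → ℝ} {γ : Measure ℝ}
    (hu : ∀ a : ℚ, Tendsto
      (fun n : ℕ => (∑ i ∈ Finset.range n, (Iic (a : ℝ)).indicator (1 : ℝ → ℝ) (u i)) / n) atTop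
      (𝓝 (cdf γ a)))
    {t : ℝ} (ht : t ∈ Ioo (0 : ℝ) 1) (hcont : ContinuousAt (quantile γ) t) :
    Tendsto (fun n : ℕ => orderStatistic u n ⌊(n : ℝ) * t⌋₊) atTop (𝓝 (quantile γ t)) := by
  have hle : ∀ n : ℕ, 0 < n → ∀ a : ℝ, (orderStatistic u n ⌊(n : ℝ) * t⌋₊ ≤ a ↔
      t < (∑ i ∈ Finset.range n, (Iic a).indicator (1 : ℝ → ℝ) (u i)) / n) := by
    intro n hn a
    have hn' : (0 : ℝ) < n := Nat.cast_pos.2 hn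
    rw [orderStatistic_le_iff u (floor_mul_lt hn ht), lt_div_iff₀ hn']
    have hcard : ∑ i ∈ Finset.range n, (Iic a).indicator (1 : ℝ → ℝ) (u i) =
        (((Finset.range n).filter fun i => u i ≤ a).card : ℝ) := by
      simp [indicator_apply, Finset.sum_boole]
    rw [hcard, Nat.cast_lt, Nat.floor_lt (by have := ht.1; positivity), mul_comm]
  refine tendsto_order.2 ⟨fun b hb => ?_, fun b hb => ?_⟩
  · obtain ⟨a, hba, ha⟩ := exists_rat_btwn hb
    have h1 := (lt_quantile_iff γ ht a).1 ha
    filter_upwards [(hu a).eventually_lt_const h1, eventually_gt_atTop 0] with n hn hn0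
    refine hba.trans (not_le.1 fun h => ?_)
    exact absurd ((hle n hn0 a).1 h) (not_lt.2 hn.le)
  · -- continuity gives a level `s > t` whose quantile is still below `b`
    have hev : ∀ᶠ s in 𝓝[>] t, quantile γ s < b :=
      (hcont.tendsto.mono_left nhdsWithin_le_nhds).eventually_lt_const hb
    obtain ⟨s, hs, hst⟩ := (hev.and (Ioo_mem_nhdsGT ht.2)).exists
    obtain ⟨a, ha, hab⟩ := exists_rat_btwn hs
    have h1 := (quantile_le_iff γ ⟨ht.1.trans hst.1, hst.2⟩ a).1 ha.le
    filter_upwards [(hu a).eventually_const_lt (hst.1.trans_le h1), eventually_gt_atTop 0]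
      with n hn hn0
    exact ((hle n hn0 a).2 hn).trans_lt hab

/-- By the strong law of large numbers there is a sample of `π` along which the empirical means of
countably many given functions converge. -/
theorem exists_sample_tendsto {E ι : Type*} [MeasurableSpace E] [Countable ι] (π : Measure E)
    [IsProbabilityMeasure π] {A : Set E} (hA : ∀ᵐ z ∂π, z ∈ A) (f : ι → E → ℝ)
    (hf : ∀ k, Measurable (f k)) (hfi : ∀ k, Integrable (f k) π) :
    ∃ p : ℕ → E, (∀ n, p n ∈ A) ∧ ∀ k,
      Tendsto (fun n : ℕ => (∑ i ∈ Finset.range n, f k (p i)) / n) atTop (𝓝 (∫ z, f k z ∂π)) := by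
  set P : Measure (ℕ → E) := Measure.infinitePi fun _ => π
  have hmp : ∀ i, MeasurePreserving (Function.eval i) P π := fun i =>
    measurePreserving_eval_infinitePi (fun _ : ℕ => π) i
  have h1 : ∀ᵐ p ∂P, ∀ n, p n ∈ A :=
    ae_all_iff.2 fun n => (hmp n).quasiMeasurePreserving.ae hA
  have h2 : ∀ᵐ p ∂P, ∀ k, Tendsto (fun n : ℕ => (∑ i ∈ Finset.range n, f k (p i)) / n) atTop
      (𝓝 (∫ z, f k z ∂π)) := by
    refine ae_all_iff.2 fun k => ?_
    have hid : ∀ i, IdentDistrib (fun p : ℕ → E => f k (p i)) (fun p => f k (p 0)) P P := by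
      intro i
      refine ⟨((hf k).comp (measurable_pi_apply i)).aemeasurable,
        ((hf k).comp (measurable_pi_apply 0)).aemeasurable, ?_⟩
      rw [show (fun p : ℕ → E => f k (p i)) = f k ∘ Function.eval i from rfl,
        show (fun p : ℕ → E => f k (p 0)) = f k ∘ Function.eval 0 from rfl,
        ← Measure.map_map (hf k) (measurable_pi_apply i),
        ← Measure.map_map (hf k) (measurable_pi_apply 0), (hmp i).map_eq, (hmp 0).map_eq]
    have hind : iIndepFun (fun i (p : ℕ → E) => f k (p i)) P :=
      iIndepFun_infinitePi fun _ => hf k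
    have hint : Integrable (fun p : ℕ → E => f k (p 0)) P :=
      (hmp 0).integrable_comp_of_integrable (hfi k)
    have := strong_law_ae_real (fun i (p : ℕ → E) => f k (p i)) hint
      (fun i j hij => hind.indepFun hij) hid
    have hE : ∫ p, f k (p 0) ∂P = ∫ z, f k z ∂π := by
      rw [← (hmp 0).map_eq, integral_map (measurable_pi_apply 0).aemeasurable
        (hf k).aestronglyMeasurable]
    rwa [hE] at this
  obtain ⟨p, hp⟩ := (h1.and h2).exists
  exact ⟨p, hp⟩

theorem lintegral_floor_le (f : ℕ → ℝ≥0∞) {n : ℕ} (hn : 0 < n) :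
    ∫⁻ t in Ioo (0 : ℝ) 1, f ⌊(n : ℝ) * t⌋₊ ≤ (∑ i ∈ Finset.range n, f i) / n := by
  have hn' : (0 : ℝ) < n := Nat.cast_pos.2 hn
  have hsub : Ioo (0 : ℝ) 1 ⊆ ⋃ i : Finset.range n, Ico ((i : ℝ) / n) ((i + 1) / n) := by
    intro t ht
    refine mem_iUnion.2 ⟨⟨⌊(n : ℝ) * t⌋₊, Finset.mem_range.2 (floor_mul_lt hn ht)⟩, ?_, ?_⟩
    · rw [div_le_iff₀ hn', mul_comm t]
      exact Nat.floor_le (by have := ht.1; positivity)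
    · rw [lt_div_iff₀ hn', mul_comm t]
      exact Nat.lt_floor_add_one _
  calc ∫⁻ t in Ioo (0 : ℝ) 1, f ⌊(n : ℝ) * t⌋₊
      ≤ ∫⁻ t in ⋃ i : Finset.range n, Ico ((i : ℝ) / n) ((i + 1) / n), f ⌊(n : ℝ) * t⌋₊ :=
        lintegral_mono_set hsub
    _ ≤ ∑' i : Finset.range n, ∫⁻ t in Ico ((i : ℝ) / n) ((i + 1) / n), f ⌊(n : ℝ) * t⌋₊ :=
        lintegral_iUnion_le _ _
    _ = ∑ i ∈ Finset.range n, ∫⁻ t in Ico ((i : ℝ) / n) ((i + 1) / n), f ⌊(n : ℝ) * t⌋₊ := by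
        rw [tsum_fintype, Finset.sum_coe_sort (Finset.range n)
          fun i : ℕ => ∫⁻ t in Ico ((i : ℝ) / n) ((i + 1) / n), f ⌊(n : ℝ) * t⌋₊]
    _ = ∑ i ∈ Finset.range n, f i / n := by
        refine Finset.sum_congr rfl fun i _ => ?_
        rw [setLIntegral_congr_fun (g := fun _ => f i) measurableSet_Ico fun t ht => ?_]
        · rw [setLIntegral_const, Real.volume_Ico, ← sub_div, add_sub_cancel_left,
            ENNReal.ofReal_div_of_pos hn', ENNReal.ofReal_one, ENNReal.ofReal_natCast,
            ENNReal.div_eq_inv_mul, mul_one, ENNReal.div_eq_inv_mul, mul_comm]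
        · have h0 : 0 ≤ (n : ℝ) * t := by
            have : 0 ≤ t := le_trans (by positivity) ht.1
            positivity
          have : ⌊(n : ℝ) * t⌋₊ = i := by
            rw [Nat.floor_eq_iff h0]
            exact ⟨by rw [mul_comm]; exact (div_le_iff₀ hn').1 ht.1,
              by rw [mul_comm]; exact (lt_div_iff₀ hn').1 ht.2⟩
          simp only [this]
    _ = (∑ i ∈ Finset.range n, f i) / n := by
        simp only [ENNReal.div_eq_inv_mul, Finset.mul_sum]

theorem ae_mem_prod_of_mem_transportPlans {X : Set ℝ} {γ ω : Measure ℝ} (hγ : γ ∈ probOn X)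
    (hω : ω ∈ probOn X) {π : Measure (ℝ × ℝ)} (hπ : π ∈ transportPlans γ ω) :
    ∀ᵐ p ∂π, p ∈ X ×ˢ X := by
  have h1 := ae_mem_of_mem_probOn hγ
  have h2 := ae_mem_of_mem_probOn hω
  rw [← hπ.2.1] at h1
  rw [← hπ.2.2] at h2
  filter_upwards [ae_of_ae_map measurable_fst.aemeasurable h1,
    ae_of_ae_map measurable_snd.aemeasurable h2] with p hp1 hp2 using ⟨hp1, hp2⟩

theorem aemeasurable_cost {X : Set ℝ} (hX : X.OrdConnected) {c : ℝ → ℝ → ℝ}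
    (hcont : ContinuousOn (Function.uncurry c) (X ×ˢ X)) {μ : Measure (ℝ × ℝ)}
    (hμ : ∀ᵐ p ∂μ, p ∈ X ×ˢ X) : AEMeasurable (Function.uncurry c) μ := by
  have := hcont.aemeasurable (μ := μ) (hX.measurableSet.prod hX.measurableSet)
  rwa [Measure.restrict_eq_self_of_ae_mem hμ] at this

/-- The comonotone coupling is optimal, without any integrability assumption: it costs at most as
much as the sorted empirical measures of a sample of `π` do in the limit, by Fatou's lemma. -/
theorem lintegral_quantile_le_of_mem_transportPlans {X : Set ℝ} (hX : X.OrdConnected)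
    {c : ℝ → ℝ → ℝ} (hnonneg : ∀ x ∈ X, ∀ y ∈ X, 0 ≤ c x y)
    (hcont : ContinuousOn (Function.uncurry c) (X ×ˢ X)) (hsub : SubmodularCostOn c X)
    {γ ω : Measure ℝ} (hγ : γ ∈ probOn X) (hω : ω ∈ probOn X) {π : Measure (ℝ × ℝ)}
    (hπ : π ∈ transportPlans γ ω) :
    ∫⁻ t in Ioo (0 : ℝ) 1, ENNReal.ofReal (c (quantile γ t) (quantile ω t)) ≤
      ∫⁻ p, ENNReal.ofReal (c p.1 p.2) ∂π := by
  have hπp : IsProbabilityMeasure π := hπ.1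
  have hγp : IsProbabilityMeasure γ := hγ.1
  have hωp : IsProbabilityMeasure ω := hω.1
  have hae := ae_mem_prod_of_mem_transportPlans hγ hω hπ
  have hms : MeasurableSet (X ×ˢ X) := hX.measurableSet.prod hX.measurableSet
  by_cases hfin : ∫⁻ p, ENNReal.ofReal (c p.1 p.2) ∂π = ∞
  · simp [hfin]
  set d : ℝ × ℝ → ℝ := (X ×ˢ X).indicator (Function.uncurry c) with hd
  have hdm : Measurable d := by
    classical
    rw [hd, ← piecewise_eq_indicator]
    exact hcont.measurable_piecewise continuousOn_const hms
  have hdae : ∀ᵐ p ∂π, c p.1 p.2 = d p := by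
    filter_upwards [hae] with p hp
    rw [hd, indicator_of_mem hp]
    rfl
  have hd0 : ∀ p, 0 ≤ d p := fun p =>
    indicator_nonneg (fun q hq => hnonneg _ hq.1 _ hq.2) p
  have hlint : ∫⁻ p, ENNReal.ofReal (c p.1 p.2) ∂π = ∫⁻ p, ENNReal.ofReal (d p) ∂π :=
    lintegral_congr_ae (hdae.mono fun p hp => by simp only [hp])
  rw [hlint] at hfin ⊢
  have hdi : Integrable d π :=
    ⟨hdm.aestronglyMeasurable,
      (hasFiniteIntegral_iff_ofReal (Eventually.of_forall hd0)).2 (lt_top_iff_ne_top.2 hfin)⟩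
  have hind : ∀ a : ℝ, Measurable ((Iic a).indicator (1 : ℝ → ℝ)) := fun a =>
    measurable_one.indicator measurableSet_Iic
  have hindint : ∀ a : ℝ, ∀ ν : Measure ℝ, IsProbabilityMeasure ν →
      Integrable ((Iic a).indicator (1 : ℝ → ℝ)) ν := fun a ν _ =>
    (integrable_const (1 : ℝ)).indicator measurableSet_Iic
  have hcdf : ∀ a : ℝ, ∀ ν : Measure ℝ, IsProbabilityMeasure ν →
      ∫ x, (Iic a).indicator (1 : ℝ → ℝ) x ∂ν = cdf ν a := fun a ν _ => by
    rw [integral_indicator_one measurableSet_Iic, cdf_eq_real]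
  have hfst : MeasurePreserving Prod.fst π γ := ⟨measurable_fst, hπ.2.1⟩
  have hsnd : MeasurePreserving Prod.snd π ω := ⟨measurable_snd, hπ.2.2⟩
  obtain ⟨p, hpX, hp⟩ := exists_sample_tendsto π hae
    (fun k : Option (ℚ ⊕ ℚ) => match k with
      | none => d
      | some (Sum.inl a) => fun z => (Iic (a : ℝ)).indicator (1 : ℝ → ℝ) z.1
      | some (Sum.inr a) => fun z => (Iic (a : ℝ)).indicator (1 : ℝ → ℝ) z.2)
    (by
      rintro (_ | a | a)
      exacts [hdm, (hind a).comp measurable_fst, (hind a).comp measurable_snd])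
    (by
      rintro (_ | a | a)
      exacts [hdi, hfst.integrable_comp_of_integrable (hindint a γ hγp),
        hsnd.integrable_comp_of_integrable (hindint a ω hωp)])
  have hp0 : Tendsto (fun n : ℕ => (∑ i ∈ Finset.range n, d (p i)) / n) atTop
      (𝓝 (∫ z, d z ∂π)) := hp none
  have hp1 : ∀ a : ℚ, Tendsto (fun n : ℕ =>
      (∑ i ∈ Finset.range n, (Iic (a : ℝ)).indicator (1 : ℝ → ℝ) (p i).1) / n) atTop
      (𝓝 (cdf γ a)) := by
    intro a
    have := hp (some (Sum.inl a))
    rwa [← hcdf a γ hγp, ← hπ.2.1,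
      integral_map measurable_fst.aemeasurable (hind a).aestronglyMeasurable]
  have hp2 : ∀ a : ℚ, Tendsto (fun n : ℕ =>
      (∑ i ∈ Finset.range n, (Iic (a : ℝ)).indicator (1 : ℝ → ℝ) (p i).2) / n) atTop
      (𝓝 (cdf ω a)) := by
    intro a
    have := hp (some (Sum.inr a))
    rwa [← hcdf a ω hωp, ← hπ.2.2,
      integral_map measurable_snd.aemeasurable (hind a).aestronglyMeasurable]
  set u : ℕ → ℝ := fun i => (p i).1
  set v : ℕ → ℝ := fun i => (p i).2
  set F : ℕ → ℝ → ℝ≥0∞ := fun n t =>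
    ENNReal.ofReal (c (orderStatistic u n ⌊(n : ℝ) * t⌋₊) (orderStatistic v n ⌊(n : ℝ) * t⌋₊))
    with hF
  have hFm : ∀ n, Measurable (F n) := fun n =>
    (measurable_from_nat (f := fun k : ℕ =>
      ENNReal.ofReal (c (orderStatistic u n k) (orderStatistic v n k)))).comp
      (Nat.measurable_floor.comp (measurable_const_mul _))
  -- `c` is only continuous relative to `X × X`, so the convergence has to stay inside it
  have hlim : ∀ᵐ t ∂volume.restrict (Ioo (0 : ℝ) 1),
      ENNReal.ofReal (c (quantile γ t) (quantile ω t)) = liminf (fun n => F n t) atTop := by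
    filter_upwards [ae_continuousAt_quantile γ, ae_continuousAt_quantile ω, ae_quantile_mem hγ,
      ae_quantile_mem hω, ae_restrict_mem measurableSet_Ioo] with t hc1 hc2 hX1 hX2 ht
    have hpair : Tendsto (fun n : ℕ => (orderStatistic u n ⌊(n : ℝ) * t⌋₊,
        orderStatistic v n ⌊(n : ℝ) * t⌋₊)) atTop
        (𝓝[X ×ˢ X] (quantile γ t, quantile ω t)) := by
      refine tendsto_nhdsWithin_iff.2 ⟨(tendsto_orderStatistic hp1 ht hc1).prodMk_nhds
        (tendsto_orderStatistic hp2 ht hc2), ?_⟩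
      filter_upwards [eventually_gt_atTop 0] with n hn
      exact ⟨orderStatistic_mem (fun i => (hpX i).1) (floor_mul_lt hn ht),
        orderStatistic_mem (fun i => (hpX i).2) (floor_mul_lt hn ht)⟩
    have h1 := (hcont (quantile γ t, quantile ω t) ⟨hX1, hX2⟩).tendsto.comp hpair
    exact (Tendsto.liminf_eq ((ENNReal.continuous_ofReal.tendsto _).comp h1)).symm
  have hle : ∀ᶠ n : ℕ in atTop, ∫⁻ t in Ioo (0 : ℝ) 1, F n t ≤
      ENNReal.ofReal ((∑ i ∈ Finset.range n, d (p i)) / n) := by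
    filter_upwards [eventually_gt_atTop 0] with n hn
    refine (lintegral_floor_le (fun k => ENNReal.ofReal
      (c (orderStatistic u n k) (orderStatistic v n k))) hn).trans ?_
    rw [ENNReal.ofReal_div_of_pos (Nat.cast_pos.2 hn), ENNReal.ofReal_natCast,
      ← ENNReal.ofReal_sum_of_nonneg fun k hk => hnonneg _
        (orderStatistic_mem (fun i => (hpX i).1) (Finset.mem_range.1 hk)) _
        (orderStatistic_mem (fun i => (hpX i).2) (Finset.mem_range.1 hk))]
    refine ENNReal.div_le_div_right (ENNReal.ofReal_le_ofReal ?_) _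
    rw [Finset.sum_range, Finset.sum_range fun i => d (p i)]
    have := hsub.sum_sort_le (x := fun i : Fin n => u i) (y := fun i : Fin n => v i)
      (fun i => (hpX i).1) (fun i => (hpX i).2)
    refine le_of_eq_of_le (Finset.sum_congr rfl fun i _ => ?_)
      (this.trans_eq (Finset.sum_congr rfl fun i _ => ?_))
    · rw [orderStatistic, orderStatistic, dif_pos i.isLt, dif_pos i.isLt]
      rfl
    · rw [hd, indicator_of_mem (hpX i)]
      rfl
  calc ∫⁻ t in Ioo (0 : ℝ) 1, ENNReal.ofReal (c (quantile γ t) (quantile ω t))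
      = ∫⁻ t in Ioo (0 : ℝ) 1, liminf (fun n => F n t) atTop := lintegral_congr_ae hlim
    _ ≤ liminf (fun n => ∫⁻ t in Ioo (0 : ℝ) 1, F n t) atTop := lintegral_liminf_le hFm
    _ ≤ liminf (fun n : ℕ => ENNReal.ofReal ((∑ i ∈ Finset.range n, d (p i)) / n)) atTop :=
        liminf_le_liminf hle
    _ = ENNReal.ofReal (∫ z, d z ∂π) :=
        ((ENNReal.continuous_ofReal.tendsto _).comp hp0).liminf_eq
    _ = ∫⁻ z, ENNReal.ofReal (d z) ∂π :=
        ofReal_integral_eq_lintegral_ofReal hdi (Eventually.of_forall hd0)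

theorem map_mem_probOn {X : Set ℝ} (hX : X.OrdConnected) {f : ℝ → ℝ}
    (hf : AEMeasurable f (volume.restrict (Ioo (0 : ℝ) 1)))
    (hfX : ∀ᵐ t ∂volume.restrict (Ioo (0 : ℝ) 1), f t ∈ X) :
    (volume.restrict (Ioo (0 : ℝ) 1)).map f ∈ probOn X := by
  refine ⟨Measure.isProbabilityMeasure_map hf, ?_⟩
  rw [Measure.map_apply_of_aemeasurable hf hX.measurableSet.compl]
  exact hfX

theorem transportCost_map_le {X : Set ℝ} (hX : X.OrdConnected) {c : ℝ → ℝ → ℝ}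
    (hcont : ContinuousOn (Function.uncurry c) (X ×ˢ X)) {f : ℝ → ℝ}
    (hf : AEMeasurable f (volume.restrict (Ioo (0 : ℝ) 1)))
    (hfX : ∀ᵐ t ∂volume.restrict (Ioo (0 : ℝ) 1), f t ∈ X) {ω : Measure ℝ} (hω : ω ∈ probOn X) :
    transportCost c ((volume.restrict (Ioo (0 : ℝ) 1)).map f) ω ≤
      ∫⁻ t in Ioo (0 : ℝ) 1, ENNReal.ofReal (c (f t) (quantile ω t)) := by
  have hωp : IsProbabilityMeasure ω := hω.1
  have hg := aemeasurable_quantile ω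
  have hfg := hf.prodMk hg
  have hplan : (volume.restrict (Ioo (0 : ℝ) 1)).map (fun t => (f t, quantile ω t)) ∈
      transportPlans ((volume.restrict (Ioo (0 : ℝ) 1)).map f) ω := by
    refine ⟨Measure.isProbabilityMeasure_map hfg, ?_, ?_⟩
    · rw [AEMeasurable.map_map_of_aemeasurable measurable_fst.aemeasurable hfg]
      rfl
    · rw [AEMeasurable.map_map_of_aemeasurable measurable_snd.aemeasurable hfg]
      exact map_quantile ω
  refine (iInf₂_le _ hplan).trans_eq ?_
  have hae := ae_mem_prod_of_mem_transportPlans (map_mem_probOn hX hf hfX) hω hplan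
  exact lintegral_map' (aemeasurable_cost hX hcont hae).ennreal_ofReal hfg

/-- The transport cost is attained by the comonotone coupling. -/
theorem transportCost_eq_lintegral_quantile {X : Set ℝ} (hX : X.OrdConnected)
    {c : ℝ → ℝ → ℝ} (hnonneg : ∀ x ∈ X, ∀ y ∈ X, 0 ≤ c x y)
    (hcont : ContinuousOn (Function.uncurry c) (X ×ˢ X)) (hsub : SubmodularCostOn c X)
    {γ ω : Measure ℝ} (hγ : γ ∈ probOn X) (hω : ω ∈ probOn X) :
    transportCost c γ ω =
      ∫⁻ t in Ioo (0 : ℝ) 1, ENNReal.ofReal (c (quantile γ t) (quantile ω t)) := by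
  have hγp : IsProbabilityMeasure γ := hγ.1
  refine le_antisymm ?_ (le_iInf₂ fun π hπ =>
    lintegral_quantile_le_of_mem_transportPlans hX hnonneg hcont hsub hγ hω hπ)
  simpa only [map_quantile] using
    transportCost_map_le hX hcont (aemeasurable_quantile γ) (ae_quantile_mem hγ) hω

/-- A negative mixed partial derivative makes `y ↦ c x' y - c x y` decreasing for `x ≤ x'`. -/
theorem submodularCostOn_of_mixedPartial_neg {X : Set ℝ} (hX : X.OrdConnected) {c : ℝ → ℝ → ℝ}
    (hdiff : TwiceDifferentiableOn c X)
    (hmixed : ∀ x ∈ X, ∀ x' ∈ X, mixedPartial c X x x' < 0) : SubmodularCostOn c X := by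
  have hconv : Convex ℝ X := hX.convex
  have hslice : ∀ x ∈ X, DifferentiableOn ℝ (c x) X := fun x hx =>
    hdiff.1.comp (f := fun t : ℝ => (x, t))
      (differentiableOn_const x |>.prodMk differentiableOn_id) fun t ht => ⟨hx, ht⟩
  have hanti : ∀ y ∈ X, AntitoneOn (fun s => derivWithin (fun t => c s t) X y) X := by
    intro y hy
    refine (strictAntiOn_of_deriv_neg hconv (fun x hx => ?_) fun x hx => ?_).antitoneOn
    · -- a nonzero `derivWithin` is a genuine derivative
      exact (differentiableWithinAt_of_derivWithin_ne_zero
        (hmixed x hx y hy).ne).continuousWithinAt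
    · rw [← derivWithin_of_mem_nhds (mem_interior_iff_mem_nhds.1 hx)]
      exact hmixed x (interior_subset hx) y hy
  intro x hx x' hx' y hy y' hy' hxx' hyy'
  have hmono : AntitoneOn (fun t => c x' t - c x t) X := by
    refine antitoneOn_of_deriv_nonpos hconv
      ((hslice x' hx').continuousOn.sub (hslice x hx).continuousOn)
      (((hslice x' hx').sub (hslice x hx)).mono interior_subset) fun t ht => ?_
    have htn := mem_interior_iff_mem_nhds.1 ht
    rw [← derivWithin_of_mem_nhds htn]
    have htX := interior_subset ht
    rw [derivWithin_fun_sub (hslice x' hx' t htX) (hslice x hx t htX)]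
    exact sub_nonpos.2 (hanti t htX hx hx' hxx')
  have := hmono hy hy' hyy'
  simp only at this
  linarith

/-! ### Aggregation of transport costs -/

theorem expLoss_coe (η r : ℝ) : expLoss η (r : EReal) = ENNReal.ofReal (Real.exp (-(η * r))) := by
  rw [expLoss, ← EReal.coe_mul, ← EReal.coe_neg, EReal.exp_coe]

theorem expLoss_top {η : ℝ} (hη : 0 < η) : expLoss η ⊤ = 0 := by
  rw [expLoss, EReal.coe_mul_top_of_pos hη, EReal.neg_top, EReal.exp_bot]

theorem expLoss_coe_ennreal (η : ℝ) {a : ℝ≥0∞} (ha : a ≠ ∞) :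
    expLoss η (a : EReal) = ENNReal.ofReal (Real.exp (-(η * a.toReal))) := by
  rw [← expLoss_coe]
  lift a to NNReal using ha
  rfl

theorem expLoss_antitone {η : ℝ} (hη : 0 ≤ η) : Antitone (expLoss η) := fun _ _ h =>
  EReal.exp_monotone (EReal.neg_le_neg_iff.2 (mul_le_mul_of_nonneg_left h (EReal.coe_nonneg.2 hη)))

/-- Mixability inequalities survive integration: `x ↦ -η⁻¹ log ∑ wₙ exp (-η xₙ)` is concave, and
the tangent plane at the vector of integrals (over the indices where these are finite) bounds the
aggregated loss from above. -/
theorem sum_expLoss_lintegral_le {Ω : Type*} [MeasurableSpace Ω] {μ : Measure Ω}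
    [IsProbabilityMeasure μ] {η : ℝ} (hη : 0 < η) {N : ℕ} {w : Fin N → ℝ}
    (hw : w ∈ stdSimplex ℝ (Fin N)) {f : Ω → ℝ} {g : Fin N → Ω → ℝ}
    (hf : ∀ᵐ t ∂μ, 0 ≤ f t) (hg : ∀ n, AEMeasurable (g n) μ) (hg0 : ∀ n, ∀ᵐ t ∂μ, 0 ≤ g n t)
    (h : ∀ᵐ t ∂μ, ∑ n, ENNReal.ofReal (w n) * expLoss η (g n t : EReal) ≤
      expLoss η (f t : EReal)) :
    ∑ n, ENNReal.ofReal (w n) * expLoss η ((∫⁻ t, ENNReal.ofReal (g n t) ∂μ : ℝ≥0∞) : EReal) ≤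
      expLoss η ((∫⁻ t, ENNReal.ofReal (f t) ∂μ : ℝ≥0∞) : EReal) := by
  classical
  set A : Fin N → ℝ≥0∞ := fun n => ∫⁻ t, ENNReal.ofReal (g n t) ∂μ with hA
  set I : Finset (Fin N) := Finset.univ.filter fun n => A n ≠ ∞ with hI
  set C : Fin N → ℝ := fun n => (A n).toReal with hC
  set p : ℝ := ∑ n ∈ I, w n * Real.exp (-(η * C n)) with hp
  have hterm : ∀ n ∈ I, 0 ≤ w n * Real.exp (-(η * C n)) := fun n _ =>
    mul_nonneg (hw.1 n) (Real.exp_pos _).le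
  have hlhs : ∑ n, ENNReal.ofReal (w n) * expLoss η (A n : EReal) = ENNReal.ofReal p := by
    rw [hp, ENNReal.ofReal_sum_of_nonneg hterm, hI, Finset.sum_filter]
    refine Finset.sum_congr rfl fun n _ => ?_
    split_ifs with hn
    · rw [expLoss_coe_ennreal η hn, ENNReal.ofReal_mul (hw.1 n)]
    · rw [not_ne_iff.1 hn, EReal.coe_ennreal_top, expLoss_top hη, mul_zero]
  rw [hlhs]
  rcases (Finset.sum_nonneg hterm).eq_or_lt with hp0 | hp0
  · rw [hp, ← hp0, ENNReal.ofReal_zero]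
    exact zero_le
  change 0 < p at hp0
  -- the normalized weights are the gradient of the aggregated loss at the vector of integrals
  set q : Fin N → ℝ := fun n => w n * Real.exp (-(η * C n)) / p with hq
  have hq0 : ∀ n ∈ I, 0 ≤ q n := fun n hn => div_nonneg (hterm n hn) hp0.le
  have hq1 : ∑ n ∈ I, q n = 1 := by
    rw [hq, ← Finset.sum_div, ← hp, div_self hp0.ne']
  have hint : ∀ n ∈ I, Integrable (g n) μ := fun n hn =>
    ⟨(hg n).aestronglyMeasurable, (hasFiniteIntegral_iff_ofReal (hg0 n)).2
      (lt_top_iff_ne_top.2 (Finset.mem_filter.1 hn).2)⟩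
  have hintC : ∀ n ∈ I, ∫ t, g n t ∂μ = C n := fun n hn =>
    integral_eq_lintegral_of_nonneg_ae (hg0 n) (hg n).aestronglyMeasurable
  set b : Ω → ℝ := fun t => -Real.log p / η + ∑ n ∈ I, q n * (g n t - C n) with hb
  have hterm_int : ∀ n ∈ I, Integrable (fun t => q n * (g n t - C n)) μ := fun n hn =>
    ((hint n hn).sub (integrable_const _)).const_mul _
  have hbi : Integrable b μ := (integrable_const _).add (integrable_finsetSum I hterm_int)
  have hbint : ∫ t, b t ∂μ = -Real.log p / η := by
    rw [hb, integral_add (integrable_const _) (integrable_finsetSum I hterm_int),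
      integral_finsetSum I hterm_int, Finset.sum_eq_zero fun n hn => ?_]
    · simp
    · rw [integral_const_mul, integral_sub (hint n hn) (integrable_const _), hintC n hn]
      simp
  have hfb : ∀ᵐ t ∂μ, f t ≤ b t := by
    filter_upwards [h] with t ht
    have h1 : ∑ n, w n * Real.exp (-(η * g n t)) ≤ Real.exp (-(η * f t)) := by
      simp only [expLoss_coe, ← ENNReal.ofReal_mul (hw.1 _)] at ht
      rwa [← ENNReal.ofReal_sum_of_nonneg fun n _ => mul_nonneg (hw.1 n) (Real.exp_pos _).le,
        ENNReal.ofReal_le_ofReal_iff (Real.exp_pos _).le] at ht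
    have h2 : p * Real.exp (∑ n ∈ I, q n * (-(η * (g n t - C n)))) ≤
        ∑ n, w n * Real.exp (-(η * g n t)) := by
      have hJ := convexOn_exp.map_sum_le (t := I) (w := q)
        (p := fun n => -(η * (g n t - C n))) hq0 hq1 fun _ _ => mem_univ _
      simp only [smul_eq_mul] at hJ
      calc p * Real.exp (∑ n ∈ I, q n * (-(η * (g n t - C n))))
          ≤ p * ∑ n ∈ I, q n * Real.exp (-(η * (g n t - C n))) :=
            mul_le_mul_of_nonneg_left hJ hp0.le
        _ = ∑ n ∈ I, w n * Real.exp (-(η * g n t)) := by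
            rw [Finset.mul_sum]
            refine Finset.sum_congr rfl fun n _ => ?_
            rw [hq, show -(η * g n t) = -(η * C n) + -(η * (g n t - C n)) by ring, Real.exp_add]
            field_simp
        _ ≤ _ := Finset.sum_le_univ_sum_of_nonneg fun n =>
            mul_nonneg (hw.1 n) (Real.exp_pos _).le
    have h3 := h2.trans h1
    nth_rewrite 1 [← Real.exp_log hp0] at h3
    rw [← Real.exp_add, Real.exp_le_exp] at h3
    have h4 : ∑ n ∈ I, q n * (-(η * (g n t - C n))) = -(η * ∑ n ∈ I, q n * (g n t - C n)) := by
      rw [Finset.mul_sum, ← Finset.sum_neg_distrib]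
      exact Finset.sum_congr rfl fun n _ => by ring
    rw [h4] at h3
    have h5 : η * f t ≤ η * b t := by
      rw [hb, mul_add, mul_div_cancel₀ _ hη.ne']
      linarith
    exact le_of_mul_le_mul_left h5 hη
  have hb0 : 0 ≤ᵐ[μ] b := by
    filter_upwards [hf, hfb] with t h1 h2 using h1.trans h2
  have hB : ∫⁻ t, ENNReal.ofReal (f t) ∂μ ≤ ENNReal.ofReal (-Real.log p / η) := by
    rw [← hbint, ofReal_integral_eq_lintegral_ofReal hbi hb0]
    exact lintegral_mono_ae (hfb.mono fun t ht => ENNReal.ofReal_le_ofReal ht)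
  have hpos : 0 ≤ -Real.log p / η := hbint ▸ integral_nonneg_of_ae hb0
  calc ENNReal.ofReal p = expLoss η ((-Real.log p / η : ℝ) : EReal) := by
        rw [expLoss_coe, mul_div_cancel₀ _ hη.ne', neg_neg, Real.exp_log hp0]
    _ ≤ _ := expLoss_antitone hη.le (by
        have := EReal.coe_ennreal_le_coe_ennreal_iff.2 hB
        rwa [EReal.coe_ennreal_ofReal, max_eq_left hpos] at this)

/-- If `f` aggregates the quantile functions pointwise, its law aggregates the measures: the
transport costs to `ω` are integrals along the comonotone couplings. -/
theorem sum_expLoss_transportCost_le {X : Set ℝ} (hX : X.OrdConnected)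
    {c : ℝ → ℝ → ℝ} (hnonneg : ∀ x ∈ X, ∀ y ∈ X, 0 ≤ c x y)
    (hcont : ContinuousOn (Function.uncurry c) (X ×ˢ X)) (hsub : SubmodularCostOn c X)
    {η : ℝ} (hη : 0 < η) {N : ℕ} {w : Fin N → ℝ} (hw : w ∈ stdSimplex ℝ (Fin N))
    {γ : Fin N → Measure ℝ} (hγ : ∀ n, γ n ∈ probOn X) {f : ℝ → ℝ}
    (hf : AEMeasurable f (volume.restrict (Ioo (0 : ℝ) 1)))
    (hagg : ∀ᵐ t ∂volume.restrict (Ioo (0 : ℝ) 1), f t ∈ X ∧ ∀ y ∈ X,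
      ∑ n, ENNReal.ofReal (w n) * expLoss η (c (quantile (γ n) t) y : EReal) ≤
        expLoss η (c (f t) y : EReal))
    {ω : Measure ℝ} (hω : ω ∈ probOn X) :
    ∑ n, ENNReal.ofReal (w n) * expLoss η (transportCost c (γ n) ω : EReal) ≤
      expLoss η (transportCost c ((volume.restrict (Ioo (0 : ℝ) 1)).map f) ω : EReal) := by
  have hωX := ae_quantile_mem hω
  have hωp : IsProbabilityMeasure ω := hω.1
  have hfX := hagg.mono fun t ht => ht.1
  have hmeas : ∀ n, AEMeasurable (fun t => c (quantile (γ n) t) (quantile ω t))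
      (volume.restrict (Ioo (0 : ℝ) 1)) := by
    intro n
    have hpair := (aemeasurable_quantile (γ n)).prodMk (aemeasurable_quantile ω)
    have hpairX : ∀ᵐ p ∂(volume.restrict (Ioo (0 : ℝ) 1)).map
        (fun t => (quantile (γ n) t, quantile ω t)), p ∈ X ×ˢ X := by
      refine (ae_map_iff (p := fun p => p ∈ X ×ˢ X) hpair
        (hX.measurableSet.prod hX.measurableSet)).2 ?_
      filter_upwards [ae_quantile_mem (hγ n), hωX] with t h1 h2 using ⟨h1, h2⟩
    exact (aemeasurable_cost hX hcont hpairX).comp_aemeasurable hpair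
  calc ∑ n, ENNReal.ofReal (w n) * expLoss η (transportCost c (γ n) ω : EReal)
      = ∑ n, ENNReal.ofReal (w n) * expLoss η ((∫⁻ t in Ioo (0 : ℝ) 1,
          ENNReal.ofReal (c (quantile (γ n) t) (quantile ω t)) : ℝ≥0∞) : EReal) := by
        refine Finset.sum_congr rfl fun n _ => ?_
        rw [transportCost_eq_lintegral_quantile hX hnonneg hcont hsub (hγ n) hω]
    _ ≤ expLoss η ((∫⁻ t in Ioo (0 : ℝ) 1,
          ENNReal.ofReal (c (f t) (quantile ω t)) : ℝ≥0∞) : EReal) := by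
        refine sum_expLoss_lintegral_le hη hw ?_ hmeas (fun n => ?_) ?_
        · filter_upwards [hfX, hωX] with t h1 h2 using hnonneg _ h1 _ h2
        · filter_upwards [ae_quantile_mem (hγ n), hωX] with t h1 h2 using hnonneg _ h1 _ h2
        · filter_upwards [hagg, hωX] with t h1 h2 using h1.2 _ h2
    _ ≤ _ := expLoss_antitone hη.le
        (EReal.coe_ennreal_le_coe_ennreal_iff.2 (transportCost_map_le hX hcont hf hfX hω))

/-! ### Measurable selection of aggregated forecasts -/

theorem IsCompact.isClosed_setOf_exists_mem_prod {Y Z : Type*} [TopologicalSpace Y]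
    [TopologicalSpace Z] {K : Set Z} (hK : IsCompact K) {R : Set (Y × Z)} (hR : IsClosed R) :
    IsClosed {y | ∃ z ∈ K, (y, z) ∈ R} := by
  have : CompactSpace K := isCompact_iff_compactSpace.1 hK
  have hcont : Continuous fun p : Y × K => (p.1, (p.2 : Z)) := by fun_prop
  convert isClosedMap_fst_of_compactSpace _ (hR.preimage hcont) using 1
  ext y
  simp

/-- A closed relation with nonempty fibres in a `σ`-compact linear order has a measurable
selection: take the least point of the fibre in the first compact set of an exhaustion that meets
the fibre. -/
theorem exists_measurable_selection {Y Z : Type*} [TopologicalSpace Y] [MeasurableSpace Y]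
    [BorelSpace Y] [TopologicalSpace Z] [LinearOrder Z] [OrderTopology Z]
    [SecondCountableTopology Z] [SigmaCompactSpace Z] [MeasurableSpace Z] [BorelSpace Z]
    {R : Set (Y × Z)} (hR : IsClosed R) (hne : ∀ y, ∃ z, (y, z) ∈ R) :
    ∃ f : Y → Z, Measurable f ∧ ∀ y, (y, f y) ∈ R := by
  classical
  set K : ℕ → Set Z := compactCovering Z
  have hK : ∀ n, IsCompact (K n) := isCompact_compactCovering Z
  have hhit : ∀ y, ∃ n, ∃ z ∈ K n, (y, z) ∈ R := fun y => by
    obtain ⟨z, hz⟩ := hne y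
    obtain ⟨n, hn⟩ := exists_mem_compactCovering z
    exact ⟨n, z, hn, hz⟩
  have hleast : ∀ y, ∃ z, IsLeast (K (Nat.find (hhit y)) ∩ {z | (y, z) ∈ R}) z := fun y =>
    ((hK _).inter_right (hR.preimage (by fun_prop : Continuous fun z : Z => (y, z)))).exists_isLeast
      (Nat.find_spec (hhit y))
  choose f hf using hleast
  refine ⟨f, measurable_of_Iic fun a => ?_, fun y => (hf y).1.2⟩
  have hmeas : ∀ {S : Set (Y × Z)}, IsClosed S → ∀ n,
      MeasurableSet {y | ∃ z ∈ K n, (y, z) ∈ S} := fun hS n =>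
    ((hK n).isClosed_setOf_exists_mem_prod hS).measurableSet
  have hRa : IsClosed (R ∩ {q : Y × Z | q.2 ≤ a}) :=
    hR.inter (isClosed_Iic.preimage continuous_snd)
  have heq : f ⁻¹' Iic a = ⋃ n : ℕ, ({y | ∃ z ∈ K n, (y, z) ∈ R} \
      ⋃ j ∈ Finset.range n, {y | ∃ z ∈ K j, (y, z) ∈ R}) ∩
      {y | ∃ z ∈ K n, (y, z) ∈ R ∩ {q : Y × Z | q.2 ≤ a}} := by
    ext y
    simp only [mem_preimage, mem_Iic, mem_iUnion, mem_inter_iff, Set.mem_sdiff, mem_ofPred_eq,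
      Finset.mem_range, not_exists, exists_prop, not_and]
    constructor
    · intro hy
      refine ⟨Nat.find (hhit y), ⟨Nat.find_spec (hhit y), fun j hj z hzK hzR => ?_⟩,
        f y, (hf y).1.1, (hf y).1.2, hy⟩
      exact Nat.find_min (hhit y) hj ⟨z, hzK, hzR⟩
    · rintro ⟨n, ⟨hn, hmin⟩, z, hzK, hzR, hza⟩
      have hfind : Nat.find (hhit y) = n :=
        (Nat.find_eq_iff (hhit y)).2 ⟨hn, fun j hj ⟨z, hz⟩ => hmin j hj z hz.1 hz.2⟩
      exact ((hf y).2 (hfind ▸ ⟨hzK, hzR⟩)).trans hza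
  rw [heq]
  exact MeasurableSet.iUnion fun n => ((hmeas hR n).diff
    (Finset.measurableSet_biUnion _ fun j _ => hmeas hR j)).inter (hmeas hRa n)

theorem sigmaCompactSpace_of_ordConnected {X : Set ℝ} (hX : X.OrdConnected) :
    SigmaCompactSpace X := by
  obtain ⟨s, hsc, hsd, hbot, htop⟩ := exists_countable_dense_bot_top X
  rw [← isSigmaCompact_iff_sigmaCompactSpace]
  have hcover : X = ⋃ p ∈ s ×ˢ s, Icc (p.1 : ℝ) p.2 := by
    ext x
    simp only [mem_iUnion]
    constructor
    · intro hx
      obtain ⟨a, ha, hax⟩ := hsd.exists_le' hbot ⟨x, hx⟩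
      obtain ⟨b, hb, hxb⟩ := hsd.exists_ge' htop ⟨x, hx⟩
      exact ⟨(a, b), ⟨ha, hb⟩, hax, hxb⟩
    · rintro ⟨p, _, hx⟩
      exact hX.out p.1.2 p.2.2 hx
  rw [hcover]
  exact isSigmaCompact_biUnion (hsc.prod hsc) fun p _ => isCompact_Icc.isSigmaCompact

theorem aemeasurable_comp_quantile {X : Set ℝ} (hX : X.OrdConnected) {N : ℕ}
    {T : (Fin N → ℝ) → ℝ} (hT : Measurable ((Set.univ.pi fun _ : Fin N => X).domRestrict T))
    {γ : Fin N → Measure ℝ} (hγ : ∀ n, γ n ∈ probOn X) :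
    AEMeasurable (fun t => T fun n => quantile (γ n) t) (volume.restrict (Ioo (0 : ℝ) 1)) := by
  have hs : MeasurableSet (Set.univ.pi fun _ : Fin N => X) :=
    MeasurableSet.univ_pi fun _ => hX.measurableSet
  have hQ : AEMeasurable (fun t n => quantile (γ n) t) (volume.restrict (Ioo (0 : ℝ) 1)) :=
    aemeasurable_pi_lambda _ fun n => aemeasurable_quantile (γ n)
  have hQX : ∀ᵐ x ∂(volume.restrict (Ioo (0 : ℝ) 1)).map (fun t n => quantile (γ n) t),
      x ∈ Set.univ.pi fun _ : Fin N => X := by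
    refine (ae_map_iff (p := fun x => x ∈ Set.univ.pi fun _ : Fin N => X) hQ hs).2 ?_
    filter_upwards [ae_all_iff.2 fun n => ae_quantile_mem (hγ n)] with t ht n _ using ht n
  have h := (aemeasurable_restrict_iff_comap_subtype (μ := (volume.restrict (Ioo (0 : ℝ) 1)).map
    (fun t n => quantile (γ n) t)) hs).2 hT.aemeasurable
  rw [Measure.restrict_eq_self_of_ae_mem hQX] at h
  exact h.comp_aemeasurable hQ

/-- Aggregating quantile functions through a measurable map that aggregates the forecasts of `c`
pointwise gives a measure that aggregates the forecasts of the transport cost. -/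
theorem map_comp_quantile_mem_and_le {X : Set ℝ} (hX : X.OrdConnected)
    {c : ℝ → ℝ → ℝ} (hnonneg : ∀ x ∈ X, ∀ y ∈ X, 0 ≤ c x y)
    (hcont : ContinuousOn (Function.uncurry c) (X ×ˢ X)) (hsub : SubmodularCostOn c X)
    {η : ℝ} (hη : 0 < η) {N : ℕ} {w : Fin N → ℝ} (hw : w ∈ stdSimplex ℝ (Fin N))
    {T : (Fin N → ℝ) → ℝ} (hTm : Measurable ((Set.univ.pi fun _ : Fin N => X).domRestrict T))
    (hT : ∀ x : Fin N → ℝ, (∀ n, x n ∈ X) → T x ∈ X ∧ ∀ y ∈ X,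
      ∑ n, ENNReal.ofReal (w n) * expLoss η (c (x n) y : EReal) ≤ expLoss η (c (T x) y : EReal))
    {γ : Fin N → Measure ℝ} (hγ : ∀ n, γ n ∈ probOn X) :
    (volume.restrict (Icc (0 : ℝ) 1)).map (fun t => T fun n => quantile (γ n) t) ∈ probOn X ∧
    ∀ ω ∈ probOn X, ∑ n, ENNReal.ofReal (w n) * expLoss η (transportCost c (γ n) ω : EReal) ≤
      expLoss η (transportCost c
        ((volume.restrict (Icc (0 : ℝ) 1)).map fun t => T fun n => quantile (γ n) t) ω : EReal) := by
  rw [← Measure.restrict_congr_set (Ioo_ae_eq_Icc (a := (0 : ℝ)) (b := 1))]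
  have hm := aemeasurable_comp_quantile hX hTm hγ
  have hagg : ∀ᵐ t ∂volume.restrict (Ioo (0 : ℝ) 1), (T fun n => quantile (γ n) t) ∈ X ∧
      ∀ y ∈ X, ∑ n, ENNReal.ofReal (w n) * expLoss η (c (quantile (γ n) t) y : EReal) ≤
        expLoss η (c (T fun n => quantile (γ n) t) y : EReal) := by
    filter_upwards [ae_all_iff.2 fun n => ae_quantile_mem (hγ n)] with t ht using hT _ ht
  exact ⟨map_mem_probOn hX hm (hagg.mono fun t ht => ht.1), fun ω hω =>
    sum_expLoss_transportCost_le hX hnonneg hcont hsub hη hw hγ hm hagg hω⟩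

/-- For fixed weights, the aggregated forecast of a mixable continuous cost can be chosen as a
measurable function of the forecasts. -/
theorem exists_measurable_aggregate {X : Set ℝ} (hX : X.OrdConnected) {c : ℝ → ℝ → ℝ}
    (hcont : ContinuousOn (Function.uncurry c) (X ×ˢ X)) {η : ℝ}
    (hmix : IsMixableOn X X η fun x x' => (c x x' : EReal)) {N : ℕ} {w : Fin N → ℝ}
    (hw : w ∈ stdSimplex ℝ (Fin N)) :
    ∃ T : (Fin N → ℝ) → ℝ, Measurable ((Set.univ.pi fun _ : Fin N => X).domRestrict T) ∧
      ∀ x : Fin N → ℝ, (∀ n, x n ∈ X) → T x ∈ X ∧ ∀ y ∈ X,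
        ∑ n, ENNReal.ofReal (w n) * expLoss η (c (x n) y : EReal) ≤
          expLoss η (c (T x) y : EReal) := by
  classical
  have := sigmaCompactSpace_of_ordConnected hX
  have hce : ∀ y : X, Continuous fun x : X => expLoss η (c x y : EReal) := by
    intro y
    simp only [expLoss_coe]
    have h1 : Continuous fun x : X => c x y :=
      hcont.comp_continuous (f := fun x : X => ((x : ℝ), (y : ℝ))) (by fun_prop)
        fun x => ⟨x.2, y.2⟩
    exact ENNReal.continuous_ofReal.comp (Real.continuous_exp.comp (continuous_const.mul h1).neg)
  set R : Set ((Fin N → X) × X) := {q | ∀ y : X,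
    ∑ n, ENNReal.ofReal (w n) * expLoss η (c (q.1 n) y : EReal) ≤ expLoss η (c q.2 y : EReal)}
    with hRdef
  have hR : IsClosed R := by
    rw [hRdef, ofPred_forall]
    refine isClosed_iInter fun y => isClosed_le ?_ ((hce y).comp continuous_snd)
    exact continuous_finsetSum _ fun n _ => (ENNReal.continuous_const_mul ENNReal.ofReal_ne_top).comp
      ((hce y).comp ((continuous_apply n).comp continuous_fst))
  obtain ⟨f, hfm, hf⟩ := exists_measurable_selection hR fun x => by
    obtain ⟨g, hgX, hg⟩ := hmix N w (fun n => (x n : ℝ)) hw fun n => (x n).2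
    exact ⟨⟨g, hgX⟩, fun y => hg y y.2⟩
  refine ⟨fun x => if h : ∀ n, x n ∈ X then (f fun n => ⟨x n, h n⟩ : ℝ) else 0, ?_, ?_⟩
  · have hval : (Set.univ.pi fun _ : Fin N => X).domRestrict
        (fun x => if h : ∀ n, x n ∈ X then (f fun n => ⟨x n, h n⟩ : ℝ) else 0) =
        fun x : (Set.univ.pi fun _ : Fin N => X) =>
          (f fun n => ⟨x.1 n, x.2 n (mem_univ n)⟩ : ℝ) := by
      ext x
      exact dif_pos fun n => x.2 n (mem_univ n)
    rw [hval]
    refine measurable_subtype_coe.comp (hfm.comp (measurable_pi_lambda _ fun n => ?_))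
    exact ((measurable_pi_apply n).comp measurable_subtype_coe).subtype_mk
  · intro x hx
    simp only [dif_pos hx]
    exact ⟨(f _).2, fun y hy => hf (fun n => ⟨x n, hx n⟩) ⟨y, hy⟩⟩

/-! ### Weighted means of quantile functions and Wasserstein barycenters -/

theorem tendsto_sum_quantile_left {N : ℕ} (w : Fin N → ℝ) (γ : Fin N → Measure ℝ) {t : ℝ}
    (ht : t ∈ Ioo (0 : ℝ) 1) :
    Tendsto (fun s => ∑ n, w n * quantile (γ n) s) (𝓝[<] t) (𝓝 (∑ n, w n * quantile (γ n) t)) :=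
  tendsto_finsetSum _ fun n _ => (tendsto_quantile_left (γ n) ht).const_mul (w n)

theorem monotoneOn_sum_quantile {N : ℕ} {w : Fin N → ℝ} (hw : ∀ n, 0 ≤ w n)
    (γ : Fin N → Measure ℝ) : MonotoneOn (fun t => ∑ n, w n * quantile (γ n) t) (Ioo 0 1) :=
  fun _ hs _ ht hst => Finset.sum_le_sum fun n _ =>
    mul_le_mul_of_nonneg_left (monotoneOn_quantile (γ n) hs ht hst) (hw n)

theorem quantile_map_sum_quantile {N : ℕ} {w : Fin N → ℝ} (hw : ∀ n, 0 ≤ w n)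
    (γ : Fin N → Measure ℝ) {t : ℝ} (ht : t ∈ Ioo (0 : ℝ) 1) :
    quantile ((volume.restrict (Ioo (0 : ℝ) 1)).map fun t => ∑ n, w n * quantile (γ n) t) t =
      ∑ n, w n * quantile (γ n) t :=
  quantile_map_of_monotoneOn (monotoneOn_sum_quantile hw γ)
    (fun _ hs => tendsto_sum_quantile_left w γ hs) ht

theorem wassersteinTwoSq_eq_lintegral_quantile (γ ω : Measure ℝ) [IsProbabilityMeasure γ]
    [IsProbabilityMeasure ω] :
    wassersteinTwoSq γ ω =
      ∫⁻ t in Ioo (0 : ℝ) 1, ENNReal.ofReal ((quantile γ t - quantile ω t) ^ 2) :=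
  transportCost_eq_lintegral_quantile (X := univ) ordConnected_univ (fun _ _ _ _ => sq_nonneg _)
    (Continuous.continuousOn (by unfold Function.uncurry; fun_prop))
    (fun x _ x' _ y _ y' _ hx hy => by nlinarith [mul_nonneg (sub_nonneg.2 hx) (sub_nonneg.2 hy)])
    ⟨inferInstance, by simp⟩ ⟨inferInstance, by simp⟩

theorem sum_mul_sub_sq {N : ℕ} {w : Fin N → ℝ} (hw : ∑ n, w n = 1) (x : Fin N → ℝ) (y : ℝ) :
    ∑ n, w n * (x n - y) ^ 2 =
      ∑ n, w n * (x n - ∑ m, w m * x m) ^ 2 + (∑ m, w m * x m - y) ^ 2 := by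
  set a := ∑ m, w m * x m with ha
  have h1 : ∀ n, w n * (x n - y) ^ 2 =
      w n * (x n - a) ^ 2 + (2 * (a - y) * (w n * x n) + (y ^ 2 - a ^ 2) * w n) := fun n => by ring
  simp only [h1, Finset.sum_add_distrib, ← Finset.mul_sum, hw, ← ha]
  ring

theorem memLp_two_quantile {γ : Measure ℝ} (hγ : γ ∈ probTwo) :
    MemLp (quantile γ) 2 (volume.restrict (Ioo (0 : ℝ) 1)) := by
  have hγp : IsProbabilityMeasure γ := hγ.1
  have h := hγ.2
  rw [← map_quantile γ] at h
  exact (memLp_map_measure_iff aestronglyMeasurable_id (aemeasurable_quantile γ)).1 h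

/-- The barycenter functional at `ν` is its value at the law with the averaged quantile function,
plus the squared distance of that law to `ν`. -/
theorem sum_wassersteinTwoSq_eq {N : ℕ} {w : Fin N → ℝ} (hw : w ∈ stdSimplex ℝ (Fin N))
    (γ : Fin N → Measure ℝ) [∀ n, IsProbabilityMeasure (γ n)] (ν : Measure ℝ)
    [IsProbabilityMeasure ν] :
    ∑ n, ENNReal.ofReal (w n) * wassersteinTwoSq (γ n) ν =
      (∫⁻ t in Ioo (0 : ℝ) 1, ENNReal.ofReal
        (∑ n, w n * (quantile (γ n) t - ∑ m, w m * quantile (γ m) t) ^ 2)) +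
      ∫⁻ t in Ioo (0 : ℝ) 1, ENNReal.ofReal
        ((∑ m, w m * quantile (γ m) t - quantile ν t) ^ 2) := by
  have hQ := fun n => aemeasurable_quantile (γ n)
  have hν := aemeasurable_quantile ν
  have hQb : AEMeasurable (fun t => ∑ m, w m * quantile (γ m) t)
      (volume.restrict (Ioo (0 : ℝ) 1)) :=
    Finset.aemeasurable_fun_sum _ fun n _ => (hQ n).const_mul _
  have hd : AEMeasurable (fun t => ENNReal.ofReal
      ((∑ m, w m * quantile (γ m) t - quantile ν t) ^ 2)) (volume.restrict (Ioo (0 : ℝ) 1)) :=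
    ((hQb.sub hν).pow_const 2).ennreal_ofReal
  rw [← lintegral_add_right' _ hd]
  calc ∑ n, ENNReal.ofReal (w n) * wassersteinTwoSq (γ n) ν
      = ∑ n, ∫⁻ t in Ioo (0 : ℝ) 1,
          ENNReal.ofReal (w n * (quantile (γ n) t - quantile ν t) ^ 2) := by
        refine Finset.sum_congr rfl fun n _ => ?_
        simp only [ENNReal.ofReal_mul (hw.1 n)]
        rw [lintegral_const_mul' _ _ ENNReal.ofReal_ne_top,
          wassersteinTwoSq_eq_lintegral_quantile]
    _ = ∫⁻ t in Ioo (0 : ℝ) 1, ∑ n,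
          ENNReal.ofReal (w n * (quantile (γ n) t - quantile ν t) ^ 2) :=
        (lintegral_finsetSum' _ fun n _ =>
          ((((hQ n).sub hν).pow_const 2).const_mul (w n)).ennreal_ofReal).symm
    _ = _ := by
        refine lintegral_congr fun t => ?_
        rw [← ENNReal.ofReal_sum_of_nonneg fun n _ => mul_nonneg (hw.1 n) (sq_nonneg _),
          sum_mul_sub_sq hw.2, ENNReal.ofReal_add (Finset.sum_nonneg fun n _ =>
            mul_nonneg (hw.1 n) (sq_nonneg _)) (sq_nonneg _)]

/-- The law with the averaged quantile function is the unique Wasserstein-2 barycenter. -/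
theorem isWassersteinTwoBarycenter_iff {N : ℕ} {w : Fin N → ℝ} (hw : w ∈ stdSimplex ℝ (Fin N))
    {γ : Fin N → Measure ℝ} (hγ : ∀ n, γ n ∈ probTwo) (ν : Measure ℝ) :
    IsWassersteinTwoBarycenter w γ ν ↔
      ν = (volume.restrict (Ioo (0 : ℝ) 1)).map fun t => ∑ n, w n * quantile (γ n) t := by
  have hγp : ∀ n, IsProbabilityMeasure (γ n) := fun n => (hγ n).1
  set Q : ℝ → ℝ := fun t => ∑ n, w n * quantile (γ n) t with hQdef
  set νb := (volume.restrict (Ioo (0 : ℝ) 1)).map Q with hνb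
  have hQL : MemLp Q 2 (volume.restrict (Ioo (0 : ℝ) 1)) :=
    memLp_finsetSum _ fun n _ => (memLp_two_quantile (hγ n)).const_mul (w n)
  have hQm : AEMeasurable Q (volume.restrict (Ioo (0 : ℝ) 1)) := hQL.1.aemeasurable
  have hp : IsProbabilityMeasure νb := Measure.isProbabilityMeasure_map hQm
  have hνb2 : νb ∈ probTwo := ⟨hp, (memLp_map_measure_iff aestronglyMeasurable_id hQm).2 hQL⟩
  set V := ∫⁻ t in Ioo (0 : ℝ) 1, ENNReal.ofReal (∑ n, w n * (quantile (γ n) t - Q t) ^ 2)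
    with hV
  have hVfin : V ≠ ∞ := by
    have hi : Integrable (fun t => ∑ n, w n * (quantile (γ n) t - Q t) ^ 2)
        (volume.restrict (Ioo (0 : ℝ) 1)) := integrable_finsetSum _ fun n _ =>
      ((memLp_two_quantile (hγ n)).sub hQL).integrable_sq.const_mul (w n)
    exact hi.lintegral_lt_top.ne
  have hsum : ∀ ν' : Measure ℝ, IsProbabilityMeasure ν' →
      ∑ n, ENNReal.ofReal (w n) * wassersteinTwoSq (γ n) ν' =
        V + ∫⁻ t in Ioo (0 : ℝ) 1, ENNReal.ofReal ((Q t - quantile ν' t) ^ 2) :=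
    fun ν' _ => sum_wassersteinTwoSq_eq hw γ ν'
  have hsumb : ∑ n, ENNReal.ofReal (w n) * wassersteinTwoSq (γ n) νb = V := by
    rw [hsum νb hp, setLIntegral_congr_fun (g := fun _ => 0) measurableSet_Ioo fun t ht => ?_]
    · simp
    · simp only [hνb, hQdef, quantile_map_sum_quantile hw.1 γ ht]
      simp
  constructor
  · rintro ⟨hν, hmin⟩
    have hνp : IsProbabilityMeasure ν := hν.1
    have h1 := hmin νb hνb2
    rw [hsumb, hsum ν hνp] at h1
    have h2 : ∫⁻ t in Ioo (0 : ℝ) 1, ENNReal.ofReal ((Q t - quantile ν t) ^ 2) = 0 := by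
      by_contra hne
      exact absurd h1 (not_le.2 (ENNReal.lt_add_right hVfin hne))
    have hd : AEMeasurable (fun t => ENNReal.ofReal ((Q t - quantile ν t) ^ 2))
        (volume.restrict (Ioo (0 : ℝ) 1)) :=
      ((hQm.sub (aemeasurable_quantile ν)).pow_const 2).ennreal_ofReal
    rw [lintegral_eq_zero_iff' hd] at h2
    rw [hνb, ← map_quantile ν]
    refine Measure.map_congr ?_
    filter_upwards [h2] with t ht
    have h3 : (Q t - quantile ν t) ^ 2 ≤ 0 := ENNReal.ofReal_eq_zero.1 ht
    have h4 : Q t - quantile ν t = 0 := by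
      simpa using le_antisymm h3 (sq_nonneg _)
    linarith
  · rintro rfl
    refine ⟨hνb2, fun ν' hν' => ?_⟩
    rw [hsumb, hsum ν' hν'.1]
    exact le_self_add

theorem isSubstitution_weightedMean {X : Set ℝ} (hX : X.OrdConnected) {Ω : Type*} {O : Set Ω}
    {η : ℝ} {loss : ℝ → Ω → EReal} (h : IsExpConcaveOn X O η loss) (N : ℕ) :
    IsSubstitution X O η loss (weightedMean (N := N)) := by
  refine fun x w hx hw => ⟨?_, h N w x hw hx⟩
  simpa [weightedMean] using
    hX.convex.sum_mem (t := Finset.univ) (fun n _ => hw.1 n) hw.2 fun n _ => hx n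

theorem implicitAggregate_weightedMean {N : ℕ} (w : Fin N → ℝ) (γ : Fin N → Measure ℝ) :
    implicitAggregate weightedMean w γ =
      (volume.restrict (Ioo (0 : ℝ) 1)).map fun t => ∑ n, w n * quantile (γ n) t := by
  rw [implicitAggregate, ← Measure.restrict_congr_set (Ioo_ae_eq_Icc (a := (0 : ℝ)) (b := 1))]
  rfl

theorem lemma2 (X : Set ℝ) (hX : X.OrdConnected) (c : ℝ → ℝ → ℝ)
    (hc_nonneg : ∀ x ∈ X, ∀ x' ∈ X, 0 ≤ c x x')
    (hc_diff : TwiceDifferentiableOn c X)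
    (hc_mixed : ∀ x ∈ X, ∀ x' ∈ X, mixedPartial c X x x' < 0)
    (η : ℝ) (hη : 0 < η) :
    -- aggregation through an arbitrary measurable substitution function of the cost
    (∀ (N : ℕ) (S : (Fin N → ℝ) → (Fin N → ℝ) → ℝ) (w : Fin N → ℝ) (γ : Fin N → Measure ℝ),
      IsSubstitution X X η (fun x x' => (c x x' : EReal)) S →
      w ∈ stdSimplex ℝ (Fin N) →
      Measurable ((Set.univ.pi fun _ : Fin N => X).domRestrict fun x => S x w) →
      (∀ n, γ n ∈ probOn X) →
        implicitAggregate S w γ ∈ probOn X ∧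
        ∀ ω ∈ probOn X,
          ∑ n, ENNReal.ofReal (w n) * expLoss η (transportCost c (γ n) ω : EReal) ≤
            expLoss η (transportCost c (implicitAggregate S w γ) ω : EReal)) ∧
    -- mixability of the transport cost
    (IsMixableOn X X η (fun x x' => (c x x' : EReal)) →
      IsMixableOn (probOn X) (probOn X) η (fun γ ω => (transportCost c γ ω : EReal))) ∧
    -- the exponentially concave case
    (IsExpConcaveOn X X η (fun x x' => (c x x' : EReal)) →
      ∀ (N : ℕ) (w : Fin N → ℝ) (γ : Fin N → Measure ℝ),
        w ∈ stdSimplex ℝ (Fin N) → (∀ n, γ n ∈ probOn X) →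
          IsSubstitution X X η (fun x x' => (c x x' : EReal)) (weightedMean (N := N)) ∧
          implicitAggregate weightedMean w γ ∈ probOn X ∧
          (∀ t ∈ Set.Ioo (0 : ℝ) 1,
            quantile (implicitAggregate weightedMean w γ) t = ∑ n, w n * quantile (γ n) t) ∧
          (∀ ω ∈ probOn X,
            ∑ n, ENNReal.ofReal (w n) * expLoss η (transportCost c (γ n) ω : EReal) ≤
              expLoss η (transportCost c (implicitAggregate weightedMean w γ) ω : EReal)) ∧
          ((∀ n, γ n ∈ probTwo) →
            ∀ ν : Measure ℝ,
              IsWassersteinTwoBarycenter w γ ν ↔ ν = implicitAggregate weightedMean w γ)) := by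
  have hcont := hc_diff.1.continuousOn
  have hsub := submodularCostOn_of_mixedPartial_neg hX hc_diff hc_mixed
  have hmean : ∀ {N : ℕ} (w : Fin N → ℝ), Measurable
      ((Set.univ.pi fun _ : Fin N => X).domRestrict fun x => weightedMean x w) := fun {N} w => by
    have h : Measurable fun x : Fin N → ℝ => weightedMean x w := by
      unfold weightedMean
      fun_prop
    exact h.comp measurable_subtype_coe
  refine ⟨fun N S w γ hS hw hSm hγ => ?_, fun hmix N w γ hw hγ => ?_, fun hexp N w γ hw hγ => ?_⟩
  · exact map_comp_quantile_mem_and_le hX hc_nonneg hcont hsub hη hw hSm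
      (fun x hx => hS x w hx hw) hγ
  · obtain ⟨T, hTm, hT⟩ := exists_measurable_aggregate hX hcont hmix hw
    exact ⟨_, map_comp_quantile_mem_and_le hX hc_nonneg hcont hsub hη hw hTm hT hγ⟩
  · have hS := isSubstitution_weightedMean hX hexp N
    have hagg := map_comp_quantile_mem_and_le hX hc_nonneg hcont hsub hη hw (hmean w)
      (fun x hx => hS x w hx hw) hγ
    refine ⟨hS, hagg.1, fun t ht => ?_, hagg.2, fun hγ2 ν => ?_⟩
    · rw [implicitAggregate_weightedMean]
      exact quantile_map_sum_quantile hw.1 γ ht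
    · rw [implicitAggregate_weightedMean]
      exact isWassersteinTwoBarycenter_iff hw hγ2 ν
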